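/- Let $C$ be a non-empty set of colors. An \emph{arena} is a tuple $\mathcal A=(V,V_1,V_2,E)$ where $V=V_1\uplus V_2$ is a non-empty set of vertices of any cardinality ($V_i$ is controlled by player $i$) and $E\subseteq V\times C\times V$ is a set of colored edges, such that every vertex of $V_1$ has an outgoing edge. It is \emph{finite} if $V$ and $E$ are finite, and \emph{one-player} if $V_2=\emptyset$. A \emph{history} is a finite path of $\mathcal A$ (with one empty history for each vertex) and a \emph{play} is an infinite path. A \emph{strategy} of player 1 maps every history ending in a vertex $v\in V_1$ to an edge with source $v$; a play is \emph{consistent} with it if every prefix of the play ending in $V_1$ (the empty prefix included) is followed in the play by the edge that the strategy chooses. An \emph{objective} is a set $W\subseteq C^\omega$. A strategy is \emph{winning from} $v$ for $W$ if every play from $v$ consistent with it has its sequence of colors in $W$; it is \emph{optimal} for $W$ if it is winning from every vertex from which player 1 has a winning strategy. $W$ is \emph{regular} if there is a regular language $A\subseteq C^*$ such that $W$ is either the set $\mathrm{Reach}(A)$ of infinite words having at least one finite prefix in $A$, or the set $\mathrm{Safe}(A)=C^\omega\setminus\mathrm{Reach}(A)$. A \emph{memory structure} is a tuple $\mathcal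 M=(M,m_{\mathrm{init}},\alpha)$ with a set $M$ of states, $m_{\mathrm{init}}\in M$ and $\alpha\colon M\times C\to M$; it is \emph{finite} if $M$ is, and $\alpha^*$ denotes the extension of $\alpha$ to finite words. A strategy $\sigma$ is \emph{based on} $\mathcal M$ if there is a function $f\colon V_1\times M\to E$ such that $\sigma(\gamma)=f(v,\alpha^*(m_{\mathrm{init}},w))$ for every history $\gamma$ ending in a vertex $v\in V_1$ and with sequence of colors $w$. We say that $\mathcal M$ \emph{suffices to play optimally for $W$} in a class of arenas if in every arena of the class player 1 has a strategy that is based on $\mathcal M$ and optimal for $W$. \textbf{Theorem.} Let $W$ be a regular (reachability or safety) objective and let $\mathcal M$ be a finite memory structure. Then $\mathcal M$ suffices to play optimally for $W$ in all arenas if and only if $\mathcal M$ suffices to play optimally for $W$ in all finite one-player arenas. -/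

import Mathlib

/-!
Turn-based games on edge-coloured graphs, (chromatic) memory structures, and regular
reachability / safety objectives over a set `C` of colours.
-/

universe u v w

namespace MemGame

/-- The finite prefix of length `n` of an infinite sequence. -/
def wordPrefix {α : Type u} (x : ℕ → α) (n : ℕ) : List α :=
  (List.range n).map x

section Objectives

variable {C : Type u}

/-- Infinite words over `C` having at least one finite prefix in `A`. -/
def reach (A : Language C) : Set (ℕ → C) :=
  {x | ∃ n, wordPrefix x n ∈ A}

/-- Infinite words over `C` having no finite prefix in `A`. -/
def safe (A : Language C) : Set (ℕ → C) :=
  (reach A)ᶜ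

/-- A regular objective: a regular reachability or a regular safety objective. -/
def IsRegularObjective (W : Set (ℕ → C)) : Prop :=
  ∃ A : Language C, A.IsRegular ∧ (W = reach A ∨ W = safe A)

end Objectives

/-- An arena with colours in `C`: a non-empty set `V` of vertices of arbitrary cardinality,
partitioned into the set `V₁` of vertices of player 1 and its complement, the vertices of
player 2, and a set `E` of coloured edges `(source, colour, target)`.
A strategy of player 1 has to choose an edge in every vertex of `V₁`, so every such vertex is
required to have an outgoing edge (otherwise there would be no strategy at all). -/
structure Arena (C : Type u) where
  V : Type w
  nonempty : Nonempty V
  V₁ : Set V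
  E : Set (V × C × V)
  exists_edge : ∀ x ∈ V₁, ∃ e ∈ E, e.1 = x

namespace Arena

variable {C : Type u}

/-- The vertices of player 2. -/
def V₂ (𝒜 : Arena.{u, w} C) : Set 𝒜.V := 𝒜.V₁ᶜ

/-- Finitely many vertices and finitely many edges. -/
def IsFinite (𝒜 : Arena.{u, w} C) : Prop :=
  Finite 𝒜.V ∧ 𝒜.E.Finite

/-- A one-player arena of player 1: player 2 controls no vertex. -/
def IsOnePlayer (𝒜 : Arena.{u, w} C) : Prop :=
  𝒜.V₂ = ∅

/-- `𝒜.IsPath x l`: the list `l` of edges of `𝒜` is a path that starts in `x`. -/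
def IsPath (𝒜 : Arena.{u, w} C) : 𝒜.V → List (𝒜.V × C × 𝒜.V) → Prop
  | _, [] => True
  | x, e :: l => e ∈ 𝒜.E ∧ e.1 = x ∧ 𝒜.IsPath e.2.2 l

/-- A history: a finite path. The first vertex is recorded so that there is one empty
history for each vertex; for a non-empty history it is the source of the first edge. -/
structure History (𝒜 : Arena.{u, w} C) where
  start : 𝒜.V
  edges : List (𝒜.V × C × 𝒜.V)
  isPath : 𝒜.IsPath start edges

/-- The last vertex of the path `l` that starts in `x`. -/
def pathOut (𝒜 : Arena.{u, w} C) : 𝒜.V → List (𝒜.V × C × 𝒜.V) → 𝒜.V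
  | x, [] => x
  | _, e :: l => 𝒜.pathOut e.2.2 l

/-- The vertex in which a history ends. -/
def History.out {𝒜 : Arena.{u, w} C} (γ : 𝒜.History) : 𝒜.V :=
  𝒜.pathOut γ.start γ.edges

/-- The finite sequence of colours of a history. -/
def History.colors {𝒜 : Arena.{u, w} C} (γ : 𝒜.History) : List C :=
  γ.edges.map fun e => e.2.1

/-- The histories that end in a vertex of player 1. -/
abbrev History₁ (𝒜 : Arena.{u, w} C) : Type (max u w) :=
  {γ : 𝒜.History // γ.out ∈ 𝒜.V₁}

/-- A play: an infinite path. -/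
structure Play (𝒜 : Arena.{u, w} C) where
  edge : ℕ → 𝒜.V × C × 𝒜.V
  edge_mem : ∀ i, edge i ∈ 𝒜.E
  edge_link : ∀ i, (edge i).2.2 = (edge (i + 1)).1

/-- The vertex from which a play starts. -/
def Play.start {𝒜 : Arena.{u, w} C} (π : 𝒜.Play) : 𝒜.V :=
  (π.edge 0).1

/-- The infinite sequence of colours of a play. -/
def Play.colors {𝒜 : Arena.{u, w} C} (π : 𝒜.Play) : ℕ → C :=
  fun i => (π.edge i).2.1

theorem isPath_wordPrefix (𝒜 : Arena.{u, w} C) (j : ℕ) :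
    ∀ f : ℕ → 𝒜.V × C × 𝒜.V, (∀ i, f i ∈ 𝒜.E) → (∀ i, (f i).2.2 = (f (i + 1)).1) →
      𝒜.IsPath (f 0).1 (wordPrefix f j) := by
  induction j with
  | zero => intro f _ _; exact trivial
  | succ j ih =>
    intro f hf hl
    have h := ih (fun i => f (i + 1)) (fun i => hf (i + 1)) (fun i => hl (i + 1))
    have e : wordPrefix f (j + 1) = f 0 :: wordPrefix (fun i => f (i + 1)) j := by
      simp [wordPrefix, List.range_succ_eq_map, Function.comp_def]
    rw [e]
    refine ⟨hf 0, rfl, ?_⟩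
    rw [hl 0]
    exact h

/-- The history formed by the first `j` edges of a play. -/
def Play.take {𝒜 : Arena.{u, w} C} (π : 𝒜.Play) (j : ℕ) : 𝒜.History where
  start := π.start
  edges := wordPrefix π.edge j
  isPath := 𝒜.isPath_wordPrefix j π.edge π.edge_mem π.edge_link

/-- A strategy of player 1: it maps every history that ends in a vertex of player 1 to an edge
whose source is that vertex. -/
structure Strategy (𝒜 : Arena.{u, w} C) where
  next : 𝒜.History₁ → 𝒜.E
  next_in : ∀ γ : 𝒜.History₁, (next γ).1.1 = γ.1.out

/-- A play is consistent with `σ` if after each of its finite prefixes (including the empty one)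
that ends in a vertex of player 1 it continues with the edge chosen by `σ`. -/
def Play.ConsistentWith {𝒜 : Arena.{u, w} C} (π : 𝒜.Play) (σ : 𝒜.Strategy) : Prop :=
  ∀ (j : ℕ) (h : (π.take j).out ∈ 𝒜.V₁), (σ.next ⟨π.take j, h⟩).1 = π.edge j

/-- `σ` is winning from `x` for `W`: all plays from `x` consistent with `σ` have their
sequence of colours in `W`. -/
def Strategy.WinningFrom {𝒜 : Arena.{u, w} C} (σ : 𝒜.Strategy) (x : 𝒜.V)
    (W : Set (ℕ → C)) : Prop :=
  ∀ π : 𝒜.Play, π.start = x → π.ConsistentWith σ → π.colors ∈ W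

/-- `σ` is optimal for `W`: this single strategy is winning from every vertex from which
player 1 has a winning strategy. -/
def Strategy.Optimal {𝒜 : Arena.{u, w} C} (σ : 𝒜.Strategy) (W : Set (ℕ → C)) : Prop :=
  ∀ x : 𝒜.V, (∃ τ : 𝒜.Strategy, τ.WinningFrom x W) → σ.WinningFrom x W

end Arena

/-- A (chromatic) memory structure with state set `M`. -/
structure MemoryStructure (C : Type u) (M : Type v) where
  init : M
  upd : M → C → M

namespace MemoryStructure

variable {C : Type u} {M : Type v}

/-- The extension of the update function to finite words. -/
def updStar (ℳ : MemoryStructure C M) (m : M) (l : List C) : M :=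
  l.foldl ℳ.upd m

end MemoryStructure

/-- `σ` is based on the memory structure `ℳ`: its choices depend only on the current vertex and
on the memory state reached from the initial one by reading the colours seen so far. -/
def Arena.Strategy.BasedOn {C : Type u} {M : Type v} {𝒜 : Arena.{u, w} C} (σ : 𝒜.Strategy)
    (ℳ : MemoryStructure C M) : Prop :=
  ∃ nxt : 𝒜.V₁ → M → 𝒜.E, ∀ γ : 𝒜.History₁,
    σ.next γ = nxt ⟨γ.1.out, γ.2⟩ (ℳ.updStar ℳ.init γ.1.colors)

/-- In the game `(𝒜, W)`, player 1 has an optimal strategy based on `ℳ`. -/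
def MemoryStructure.SufficesIn {C : Type u} {M : Type v} (ℳ : MemoryStructure C M)
    (W : Set (ℕ → C)) (𝒜 : Arena.{u, w} C) : Prop :=
  ∃ σ : 𝒜.Strategy, σ.BasedOn ℳ ∧ σ.Optimal W

end MemGame

/-!
The residuals of a regular objective `W`, i.e. the sets of continuations that `W` accepts after the
finite words, are finitely many. Two conditions on a finite memory structure decide whether it
suffices. Strong monotony: the residuals reached in one memory state form a chain. Progress
consistency, for reachability: a loop of the memory structure that strictly improves the residual
wins when it is repeated forever.

Each condition is necessary already for finite one-player arenas. Given a violation of the first,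
the two incomparable residuals are told apart by ultimately periodic words, and in a finite arena
player 1 can choose between these words only after histories that the memory structure does not
distinguish. Given a violation of the second, player 1 may go round the loop or leave it for an
ultimately periodic word that wins only once the loop has been taken.

Conversely, consider pairs of a vertex and an objective that remains to be achieved from there. By
strong monotony there is a least residual among those compatible with the memory state for which
the current vertex is won; player 1 acts as if it were the objective. This guess always
underestimates the true residual. A pair that is won for a reachability objective is in the
attractor to the pairs with objective `Set.univ`, and as long as the guess is updated exactly, the
ordinal rank in this attractor decreases; hence a losing play improves the guess infinitely often.
For safety this is impossible, because the guess becomes empty as soon as the play is lost. For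
reachability two of the improvements agree on the memory state, the guess and the true residual,
and progress consistency for the loop between them shows that this residual is everything.
-/

namespace MemGame

section Words

variable {C : Type u}

@[simp]
theorem wordPrefix_zero (x : ℕ → C) : wordPrefix x 0 = [] :=
  rfl

@[simp]
theorem length_wordPrefix (x : ℕ → C) (n : ℕ) : (wordPrefix x n).length = n := by
  rw [wordPrefix, List.length_map, List.length_range]

theorem wordPrefix_succ (x : ℕ → C) (n : ℕ) :
    wordPrefix x (n + 1) = wordPrefix x n ++ [x n] := by
  simp only [wordPrefix, List.range_succ, List.map_append, List.map_singleton]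

theorem wordPrefix_inj {x y : ℕ → C} {n : ℕ} :
    wordPrefix x n = wordPrefix y n ↔ ∀ k < n, x k = y k := by
  simp only [wordPrefix, List.map_inj_left, List.mem_range]

theorem wordPrefix_eq_take (x : ℕ → C) (n : ℕ) : wordPrefix x n = Stream'.take n x := by
  induction n with
  | zero => rfl
  | succ n ih =>
    rw [wordPrefix_succ, ih]
    exact (Stream'.take_succ' n).symm

theorem map_wordPrefix {D : Type v} (f : C → D) (x : ℕ → C) (n : ℕ) :
    (wordPrefix x n).map f = wordPrefix (fun k => f (x k)) n :=
  List.map_map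

/-- The infinite word obtained by dropping the first `n` letters of `x`. -/
def wordSuffix (x : ℕ → C) (n : ℕ) : ℕ → C :=
  Stream'.drop n x

/-- The infinite word that starts with `w` and continues with `x`. -/
def prepend (w : List C) (x : ℕ → C) : ℕ → C :=
  w ++ₛ x

@[simp]
theorem wordSuffix_zero (x : ℕ → C) : wordSuffix x 0 = x :=
  rfl

theorem wordSuffix_apply (x : ℕ → C) (m n : ℕ) : wordSuffix x m n = x (m + n) :=
  congrArg x (Nat.add_comm n m)

theorem wordSuffix_wordSuffix (x : ℕ → C) (m n : ℕ) :
    wordSuffix (wordSuffix x m) n = wordSuffix x (m + n) :=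
  Stream'.drop_drop n m x

theorem prepend_append (w₁ w₂ : List C) (x : ℕ → C) :
    prepend (w₁ ++ w₂) x = prepend w₁ (prepend w₂ x) :=
  Stream'.append_append_stream w₁ w₂ x

theorem prepend_wordPrefix_wordSuffix (x : ℕ → C) (n : ℕ) :
    prepend (wordPrefix x n) (wordSuffix x n) = x := by
  rw [wordPrefix_eq_take]
  exact Stream'.append_take_drop n x

theorem prepend_singleton_wordSuffix (x : ℕ → C) : prepend [x 0] (wordSuffix x 1) = x :=
  prepend_wordPrefix_wordSuffix x 1

theorem wordSuffix_prepend_length (w : List C) (x : ℕ → C) :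
    wordSuffix (prepend w x) w.length = x :=
  Stream'.drop_append_stream w x

theorem wordPrefix_add (x : ℕ → C) (m n : ℕ) :
    wordPrefix x (m + n) = wordPrefix x m ++ wordPrefix (wordSuffix x m) n := by
  rw [wordPrefix_eq_take, wordPrefix_eq_take, wordPrefix_eq_take]
  exact Stream'.take_add m n x

theorem wordPrefix_prepend_of_le {w : List C} {n : ℕ} (x : ℕ → C) (h : n ≤ w.length) :
    wordPrefix (prepend w x) n = w.take n := by
  rw [wordPrefix_eq_take]
  exact Stream'.take_append_of_le_length n w x h

theorem wordPrefix_prepend_length (w : List C) (x : ℕ → C) :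
    wordPrefix (prepend w x) w.length = w := by
  rw [wordPrefix_prepend_of_le x le_rfl, List.take_length]

theorem wordPrefix_prepend_length_add (w : List C) (x : ℕ → C) (n : ℕ) :
    wordPrefix (prepend w x) (w.length + n) = w ++ wordPrefix x n := by
  rw [wordPrefix_add, wordPrefix_prepend_length, wordSuffix_prepend_length]

/-- The residual (left quotient) of a set of infinite words by a finite word: the continuations
that `W` accepts after `w`. -/
def residual (W : Set (ℕ → C)) (w : List C) : Set (ℕ → C) :=
  {x | prepend w x ∈ W}

theorem mem_residual {W : Set (ℕ → C)} {w : List C} {x : ℕ → C} :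
    x ∈ residual W w ↔ prepend w x ∈ W :=
  Iff.rfl

@[simp]
theorem residual_nil (W : Set (ℕ → C)) : residual W [] = W :=
  rfl

theorem residual_append (W : Set (ℕ → C)) (w₁ w₂ : List C) :
    residual W (w₁ ++ w₂) = residual (residual W w₁) w₂ := by
  ext x
  simp only [mem_residual, prepend_append]

@[simp]
theorem residual_univ (w : List C) : residual (Set.univ : Set (ℕ → C)) w = Set.univ :=
  rfl

@[simp]
theorem residual_empty (w : List C) : residual (∅ : Set (ℕ → C)) w = ∅ :=
  rfl

theorem residual_compl (W : Set (ℕ → C)) (w : List C) : residual Wᶜ w = (residual W w)ᶜ :=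
  rfl

theorem residual_mono {W W' : Set (ℕ → C)} (h : W ⊆ W') (w : List C) :
    residual W w ⊆ residual W' w :=
  fun _ hx => h hx

theorem wordSuffix_mem_residual_wordPrefix {W : Set (ℕ → C)} {x : ℕ → C} (n : ℕ) :
    wordSuffix x n ∈ residual W (wordPrefix x n) ↔ x ∈ W := by
  rw [mem_residual, prepend_wordPrefix_wordSuffix]

theorem residual_wordPrefix_eq_univ_of_le {W : Set (ℕ → C)} {x : ℕ → C} {m n : ℕ} (hmn : m ≤ n)
    (h : residual W (wordPrefix x m) = Set.univ) : residual W (wordPrefix x n) = Set.univ := by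
  obtain ⟨k, rfl⟩ := Nat.exists_eq_add_of_le hmn
  rw [wordPrefix_add, residual_append, h, residual_univ]

/-- The words with finitely many suffixes; these are the words `l ++ t ++ t ++ ⋯`. -/
def UltimatelyPeriodic (x : ℕ → C) : Prop :=
  (Set.range (wordSuffix x)).Finite

theorem ultimatelyPeriodic_of_wordSuffix_eq {x : ℕ → C} {i j : ℕ} (hij : i < j)
    (h : wordSuffix x i = wordSuffix x j) : UltimatelyPeriodic x := by
  refine ((Set.finite_Iio j).image (wordSuffix x)).subset ?_
  rintro _ ⟨n, rfl⟩
  induction n using Nat.strong_induction_on with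
  | _ n ih =>
    rcases lt_or_ge n j with hn | hn
    · exact ⟨n, hn, rfl⟩
    · have hx : wordSuffix x n = wordSuffix x (i + (n - j)) := by
        rw [← wordSuffix_wordSuffix, h, wordSuffix_wordSuffix, Nat.add_sub_cancel' hn]
      rw [hx]
      exact ih (i + (n - j)) (by omega)

theorem exists_prepend_eq_self {t : List C} (ht : t ≠ []) : ∃ x, prepend t x = x :=
  ⟨Stream'.cycle t ht, (Stream'.cycle_eq t ht).symm⟩

theorem wordSuffix_mul_length {t : List C} {x : ℕ → C} (hx : prepend t x = x) (k : ℕ) :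
    wordSuffix x (k * t.length) = x := by
  induction k with
  | zero => rw [Nat.zero_mul, wordSuffix_zero]
  | succ k ih =>
    rw [Nat.succ_mul, ← wordSuffix_wordSuffix, ih]
    nth_rw 1 [← hx]
    rw [wordSuffix_prepend_length]

theorem wordPrefix_succ_mul_length {t : List C} {x : ℕ → C} (hx : prepend t x = x) (k : ℕ) :
    wordPrefix x ((k + 1) * t.length) = wordPrefix x (k * t.length) ++ t := by
  rw [Nat.succ_mul, wordPrefix_add, wordSuffix_mul_length hx]
  nth_rw 2 [← hx]
  rw [wordPrefix_prepend_length]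

theorem ultimatelyPeriodic_prepend {t : List C} (ht : t ≠ []) {x : ℕ → C} (hx : prepend t x = x)
    (l : List C) : UltimatelyPeriodic (prepend l x) := by
  refine ultimatelyPeriodic_of_wordSuffix_eq (i := l.length) (j := l.length + 1 * t.length)
    (Nat.lt_add_of_pos_right (by rw [one_mul]; exact List.length_pos_iff.2 ht)) ?_
  rw [← wordSuffix_wordSuffix, wordSuffix_prepend_length, wordSuffix_mul_length hx]

/-- The regular reachability objectives in terms of residuals: there are finitely many of them,
and each word of the set has a prefix all of whose continuations are in the set. -/
structure IsRegularReach (W : Set (ℕ → C)) : Prop where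
  finite_residuals : (Set.range (residual W)).Finite
  exists_residual_eq_univ : ∀ x ∈ W, ∃ n, residual W (wordPrefix x n) = Set.univ

theorem residual_reach_of_prefix_mem {A : Language C} {v w : List C} (hv : v ∈ A)
    (hvw : v <+: w) : residual (reach A) w = Set.univ := by
  obtain ⟨t, rfl⟩ := hvw
  refine Set.eq_univ_of_forall fun x => ⟨v.length, ?_⟩
  rwa [prepend_append, wordPrefix_prepend_length]

theorem residual_reach_of_forall_not_prefix {A : Language C} {w : List C}
    (hw : ∀ v ∈ A, ¬ v <+: w) : residual (reach A) w = reach (A.leftQuotient w) := by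
  ext x
  constructor
  · rintro ⟨n, hn⟩
    rcases le_total n w.length with hle | hle
    · rw [wordPrefix_prepend_of_le x hle] at hn
      exact absurd (List.take_prefix n w) (hw _ hn)
    · obtain ⟨k, rfl⟩ := Nat.exists_eq_add_of_le hle
      rw [wordPrefix_prepend_length_add] at hn
      exact ⟨k, hn⟩
  · rintro ⟨k, hk⟩
    exact ⟨w.length + k, by rwa [wordPrefix_prepend_length_add]⟩

theorem isRegularReach_reach {A : Language C} (hA : A.IsRegular) : IsRegularReach (reach A) where
  finite_residuals := by
    have hfin : (Set.range A.leftQuotient).Finite :=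
      Language.isRegular_iff_finite_range_leftQuotient.1 hA
    refine ((hfin.image reach).union (Set.finite_singleton Set.univ)).subset ?_
    rintro _ ⟨w, rfl⟩
    by_cases! h : ∃ v ∈ A, v <+: w
    · obtain ⟨v, hv, hvw⟩ := h
      exact Or.inr (residual_reach_of_prefix_mem hv hvw)
    · exact Or.inl ⟨_, ⟨w, rfl⟩, (residual_reach_of_forall_not_prefix h).symm⟩
  exists_residual_eq_univ := by
    rintro x ⟨n, hn⟩
    exact ⟨n, residual_reach_of_prefix_mem hn (List.prefix_refl _)⟩

theorem IsRegularObjective.isRegularReach_or_compl {W : Set (ℕ → C)} (hW : IsRegularObjective W) :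
    IsRegularReach W ∨ IsRegularReach Wᶜ := by
  obtain ⟨A, hA, rfl | rfl⟩ := hW
  · exact Or.inl (isRegularReach_reach hA)
  · right
    rw [safe, compl_compl]
    exact isRegularReach_reach hA

theorem IsRegularReach.finite_residuals_compl {W : Set (ℕ → C)} (hW : IsRegularReach W) :
    (Set.range (MemGame.residual Wᶜ)).Finite := by
  refine (hW.finite_residuals.image compl).subset ?_
  rintro _ ⟨w, rfl⟩
  exact ⟨_, Set.mem_range_self w, rfl⟩

theorem IsRegularReach.residual {W : Set (ℕ → C)} (hW : IsRegularReach W) (w : List C) :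
    IsRegularReach (residual W w) where
  finite_residuals := by
    refine hW.finite_residuals.subset ?_
    rintro _ ⟨w', rfl⟩
    exact ⟨w ++ w', residual_append _ _ _⟩
  exists_residual_eq_univ x hx := by
    obtain ⟨n, hn⟩ := hW.exists_residual_eq_univ _ hx
    refine ⟨n, ?_⟩
    rw [← residual_append, ← wordPrefix_prepend_length_add]
    exact residual_wordPrefix_eq_univ_of_le (Nat.le_add_left _ _) hn

theorem residual_wordPrefix_mul_length {R : Set (ℕ → C)} {t : List C} {x : ℕ → C}
    (hR : residual R t = R) (hx : prepend t x = x) (k : ℕ) :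
    residual R (wordPrefix x (k * t.length)) = R := by
  induction k with
  | zero => rw [Nat.zero_mul, wordPrefix_zero, residual_nil]
  | succ k ih => rw [wordPrefix_succ_mul_length hx, residual_append, ih, hR]

theorem IsRegularReach.eq_univ_of_residual_eq_self {R : Set (ℕ → C)} (hR : IsRegularReach R)
    {t : List C} (ht : t ≠ []) (hRt : MemGame.residual R t = R) {x : ℕ → C}
    (hx : prepend t x = x) (hxR : x ∈ R) : R = Set.univ := by
  obtain ⟨n, hn⟩ := hR.exists_residual_eq_univ x hxR
  rw [← residual_wordPrefix_mul_length hRt hx n]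
  exact residual_wordPrefix_eq_univ_of_le (Nat.le_mul_of_pos_right n (List.length_pos_iff.2 ht)) hn

/-- Follow `x` until membership in `R` is decided and then until a residual of `R'` repeats. Going
round this loop forever stays in `R`, and it could enter `R'` only if `R'` had been entered before
the loop. -/
theorem exists_ultimatelyPeriodic_mem_diff {R R' : Set (ℕ → C)} (hR : IsRegularReach R)
    (hR' : IsRegularReach R') {x : ℕ → C} (hx : x ∈ R) (hx' : x ∉ R') :
    ∃ y, UltimatelyPeriodic y ∧ y ∈ R ∧ y ∉ R' := by
  obtain ⟨n, hn⟩ := hR.exists_residual_eq_univ x hx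
  obtain ⟨i, j, hij, hres⟩ := hR'.finite_residuals.exists_lt_map_eq_of_forall_mem
    (f := fun k => residual R' (wordPrefix x (n + k))) fun k => Set.mem_range_self _
  set l := wordPrefix x (n + i)
  set t := wordPrefix (wordSuffix x (n + i)) (j - i)
  have ht : t ≠ [] := by
    rw [← List.length_pos_iff, length_wordPrefix]
    omega
  have hloop : residual (residual R' l) t = residual R' l := by
    rw [← residual_append, ← wordPrefix_add, Nat.add_assoc, Nat.add_sub_cancel' hij.le]
    exact hres.symm
  obtain ⟨y, hy⟩ := exists_prepend_eq_self ht
  refine ⟨prepend l y, ultimatelyPeriodic_prepend ht hy l, ?_, fun hmem => hx' ?_⟩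
  · rw [← mem_residual, residual_wordPrefix_eq_univ_of_le (Nat.le_add_right n i) hn]
    trivial
  · rw [← wordSuffix_mem_residual_wordPrefix (n + i),
      (hR'.residual l).eq_univ_of_residual_eq_self ht hloop hy hmem]
    trivial

theorem exists_ultimatelyPeriodic_mem_residual_diff {W : Set (ℕ → C)}
    (hW : IsRegularReach W ∨ IsRegularReach Wᶜ) {u u' : List C} {x : ℕ → C}
    (hx : x ∈ residual W u) (hx' : x ∉ residual W u') :
    ∃ y, UltimatelyPeriodic y ∧ y ∈ residual W u ∧ y ∉ residual W u' := by
  rcases hW with hW | hW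
  · exact exists_ultimatelyPeriodic_mem_diff (hW.residual u) (hW.residual u') hx hx'
  · obtain ⟨y, hy, hyu', hyu⟩ := exists_ultimatelyPeriodic_mem_diff (hW.residual u')
      (hW.residual u) (x := x) hx' (not_not.2 hx)
    exact ⟨y, hy, not_not.1 hyu, hyu'⟩

end Words

namespace Arena

variable {C : Type u} {𝒜 : Arena.{u, w} C}

section Plays

theorem pathOut_concat (x : 𝒜.V) (l : List (𝒜.V × C × 𝒜.V)) (e : 𝒜.V × C × 𝒜.V) :
    𝒜.pathOut x (l ++ [e]) = e.2.2 := by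
  induction l generalizing x with
  | nil => rfl
  | cons a _ ih => exact ih a.2.2

@[simp]
theorem Play.out_take (π : 𝒜.Play) (n : ℕ) : (π.take n).out = (π.edge n).1 := by
  cases n with
  | zero => rfl
  | succ n =>
    change 𝒜.pathOut _ (wordPrefix π.edge (n + 1)) = _
    rw [wordPrefix_succ, pathOut_concat, π.edge_link]

theorem Play.colors_take (π : 𝒜.Play) (n : ℕ) : (π.take n).colors = wordPrefix π.colors n :=
  map_wordPrefix _ _ _

/-- The play without its first edge. -/
def Play.tail (π : 𝒜.Play) : 𝒜.Play where
  edge n := π.edge (n + 1)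
  edge_mem n := π.edge_mem (n + 1)
  edge_link n := π.edge_link (n + 1)

/-- The play that takes the edge `e` and continues with `π`. -/
def Play.cons (e : 𝒜.V × C × 𝒜.V) (he : e ∈ 𝒜.E) (π : 𝒜.Play) (hπ : π.start = e.2.2) :
    𝒜.Play where
  edge n := n.casesOn e π.edge
  edge_mem n := by cases n with
    | zero => exact he
    | succ n => exact π.edge_mem n
  edge_link n := by cases n with
    | zero => exact hπ.symm
    | succ n => exact π.edge_link n

theorem Play.colors_cons (e : 𝒜.V × C × 𝒜.V) (he : e ∈ 𝒜.E) (π : 𝒜.Play)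
    (hπ : π.start = e.2.2) : (Play.cons e he π hπ).colors = prepend [e.2.1] π.colors := by
  funext n
  cases n <;> rfl

/-- The history with no edge, in the vertex `x`. -/
def History.nil (x : 𝒜.V) : 𝒜.History := ⟨x, [], trivial⟩

/-- The history that takes the edge `e` and continues with `γ`. -/
def History.cons (e : 𝒜.V × C × 𝒜.V) (he : e ∈ 𝒜.E) (γ : 𝒜.History) (hγ : γ.start = e.2.2) :
    𝒜.History where
  start := e.1
  edges := e :: γ.edges
  isPath := ⟨he, rfl, hγ ▸ γ.isPath⟩

theorem History.out_cons (e : 𝒜.V × C × 𝒜.V) (he : e ∈ 𝒜.E) (γ : 𝒜.History)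
    (hγ : γ.start = e.2.2) : (History.cons e he γ hγ).out = γ.out := by
  rw [History.out, History.out, hγ]
  rfl

theorem History.cons_take_tail (π : 𝒜.Play) (n : ℕ) :
    History.cons (π.edge 0) (π.edge_mem 0) (π.tail.take n) (π.edge_link 0).symm =
      π.take (n + 1) := by
  simp only [History.cons, Play.take, Play.start, wordPrefix, List.range_succ_eq_map,
    List.map_cons, List.map_map]
  rfl

open Classical in
/-- The strategy that plays from the target of the edge `e` as `τ` does after this edge. -/
noncomputable def Strategy.after (τ : 𝒜.Strategy) (e : 𝒜.V × C × 𝒜.V) (he : e ∈ 𝒜.E) :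
    𝒜.Strategy where
  next γ :=
    if hγ : γ.1.start = e.2.2 then
      τ.next ⟨History.cons e he γ.1 hγ, (History.out_cons e he γ.1 hγ).symm ▸ γ.2⟩
    else τ.next γ
  next_in γ := by
    split_ifs with hγ
    · rw [τ.next_in, History.out_cons]
    · exact τ.next_in γ

theorem Strategy.next_after_take_tail (τ : 𝒜.Strategy) (π : 𝒜.Play) (n : ℕ)
    (h : (π.tail.take n).out ∈ 𝒜.V₁) (h' : (π.take (n + 1)).out ∈ 𝒜.V₁) :
    (τ.after (π.edge 0) (π.edge_mem 0)).next ⟨π.tail.take n, h⟩ = τ.next ⟨π.take (n + 1), h'⟩ := by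
  have hstart : (π.tail.take n).start = (π.edge 0).2.2 := (π.edge_link 0).symm
  simp only [Strategy.after, dif_pos hstart, History.cons_take_tail]

/-- The strategy `τ` does not exclude the edge `e` as first edge of a play. -/
def Strategy.Allows (τ : 𝒜.Strategy) (e : 𝒜.V × C × 𝒜.V) : Prop :=
  ∀ h : e.1 ∈ 𝒜.V₁, (τ.next ⟨History.nil e.1, h⟩).1 = e

theorem Strategy.exists_allows (τ : 𝒜.Strategy) {x : 𝒜.V} (hx : x ∈ 𝒜.V₁) :
    ∃ e ∈ 𝒜.E, e.1 = x ∧ τ.Allows e := by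
  have hin := τ.next_in ⟨History.nil x, hx⟩
  have hnext : ∀ y (hy : y ∈ 𝒜.V₁), y = x →
      τ.next ⟨History.nil y, hy⟩ = τ.next ⟨History.nil x, hx⟩ := by
    rintro _ _ rfl
    rfl
  exact ⟨_, (τ.next ⟨History.nil x, hx⟩).2, hin, fun h => congrArg Subtype.val (hnext _ h hin)⟩

theorem Play.ConsistentWith.of_tail {π : 𝒜.Play} {τ : 𝒜.Strategy} (hall : τ.Allows (π.edge 0))
    (h : π.tail.ConsistentWith (τ.after (π.edge 0) (π.edge_mem 0))) : π.ConsistentWith τ := by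
  rintro (_ | n) hn
  · exact hall hn
  · have hn' : (π.tail.take n).out ∈ 𝒜.V₁ := by
      rw [Play.out_take] at hn ⊢
      exact hn
    rw [← τ.next_after_take_tail π n hn' hn]
    exact h n hn'

theorem Play.consistentWith_of_forall_allows {π : 𝒜.Play} {τ : ℕ → 𝒜.Strategy}
    (hall : ∀ n, (τ n).Allows (π.edge n))
    (hτ : ∀ n, τ (n + 1) = (τ n).after (π.edge n) (π.edge_mem n)) : π.ConsistentWith (τ 0) := by
  intro n
  induction n generalizing π τ with
  | zero => exact hall 0
  | succ n ih =>
    intro hn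
    have hn' : (π.tail.take n).out ∈ 𝒜.V₁ := by
      rw [Play.out_take] at hn ⊢
      exact hn
    rw [← (τ 0).next_after_take_tail π n hn' hn, ← hτ 0]
    exact ih (π := π.tail) (τ := fun n => τ (n + 1)) (fun n => hall (n + 1))
      (fun n => hτ (n + 1)) hn'

theorem Strategy.WinningFrom.after {τ : 𝒜.Strategy} {W : Set (ℕ → C)} {e : 𝒜.V × C × 𝒜.V}
    (hτ : τ.WinningFrom e.1 W) (he : e ∈ 𝒜.E) (hall : τ.Allows e) :
    (τ.after e he).WinningFrom e.2.2 (residual W [e.2.1]) := by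
  intro π hπ hcons
  rw [mem_residual, ← Play.colors_cons e he π hπ]
  exact hτ _ rfl (Play.ConsistentWith.of_tail hall hcons)

end Plays

end Arena

section LeastFixedPoint

open OrdinalApprox

variable {α : Type u} (f : Set α →o Set α)

/-- The first stage at which `a` enters the ordinal-indexed approximation of the least fixed point
of `f` from below (`0` outside of the least fixed point). -/
noncomputable def lfpRank (a : α) : Ordinal.{u} :=
  sInf {o | a ∈ lfpApprox f ⊥ o}

theorem mem_map_lfpRank_lt {a : α} (ha : a ∈ f.lfp) :
    a ∈ f {b ∈ f.lfp | lfpRank f b < lfpRank f a} := by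
  have hstage : a ∈ lfpApprox f ⊥ (lfpRank f a) := by
    obtain ⟨o, ho⟩ := lfp_mem_range_lfpApprox f
    exact csInf_mem (s := {o | a ∈ lfpApprox f ⊥ o}) ⟨o, by rwa [Set.mem_ofPred_eq, ho]⟩
  rw [lfpApprox, bot_sup_eq] at hstage
  obtain ⟨o, ho, hao⟩ := Set.mem_iUnion₂.1 hstage
  refine f.mono (fun b hb => ?_) hao
  have hle : lfpApprox f ⊥ o ≤ f.lfp :=
    lfpApprox_le_of_mem_fixedPoints f f.map_lfp bot_le o
  exact ⟨hle hb, (csInf_le' (s := {o | b ∈ lfpApprox f ⊥ o}) hb).trans_lt ho⟩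

end LeastFixedPoint

namespace Arena

variable {C : Type u} {𝒜 : Arena.{u, w} C}

section Positions

variable (𝒜) in
/-- A vertex together with the objective that remains to be achieved from there. -/
abbrev Position : Type (max u w) := 𝒜.V × Set (ℕ → C)

/-- The position reached from `p` through the edge `e`. -/
def move (p : 𝒜.Position) (e : 𝒜.V × C × 𝒜.V) : 𝒜.Position :=
  (e.2.2, residual p.2 [e.2.1])

variable (𝒜) in
/-- The positions from which player 1 can force the next position to be in `X`. A dead end of
player 2 counts as such a position: no play passes through it. -/
def controlPre : Set 𝒜.Position →o Set 𝒜.Position where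
  toFun X := {p | (p.1 ∈ 𝒜.V₁ ∧ ∃ e ∈ 𝒜.E, e.1 = p.1 ∧ move p e ∈ X) ∨
    (p.1 ∉ 𝒜.V₁ ∧ ∀ e ∈ 𝒜.E, e.1 = p.1 → move p e ∈ X)}
  monotone' := by
    rintro X Y hXY p (⟨hp, e, he, hsrc, hX⟩ | ⟨hp, hX⟩)
    · exact Or.inl ⟨hp, e, he, hsrc, hXY hX⟩
    · exact Or.inr ⟨hp, fun e he hsrc => hXY (hX e he hsrc)⟩

/-- The position of the play `π` for the objective `W` after `n` edges. -/
def Play.position (π : 𝒜.Play) (W : Set (ℕ → C)) (n : ℕ) : 𝒜.Position :=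
  ((π.edge n).1, residual W (wordPrefix π.colors n))

theorem exists_allows_move_notMem {Y : Set 𝒜.Position} (hY : 𝒜.controlPre Y ⊆ Y)
    {p : 𝒜.Position} (hp : p ∉ Y) (τ : 𝒜.Strategy) :
    ∃ e ∈ 𝒜.E, e.1 = p.1 ∧ τ.Allows e ∧ move p e ∉ Y := by
  by_cases hV : p.1 ∈ 𝒜.V₁
  · obtain ⟨e, he, hsrc, hall⟩ := τ.exists_allows hV
    exact ⟨e, he, hsrc, hall, fun hmem => hp (hY (Or.inl ⟨hV, e, he, hsrc, hmem⟩))⟩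
  · by_contra! hall
    exact hp (hY (Or.inr ⟨hV, fun e he hsrc =>
      hall e he hsrc fun h => absurd (hsrc ▸ h) hV⟩))

theorem Play.position_succ (π : 𝒜.Play) (W : Set (ℕ → C)) (n : ℕ) :
    π.position W (n + 1) = move (π.position W n) (π.edge n) := by
  rw [Play.position, Play.position, move, π.edge_link, wordPrefix_succ, residual_append]
  rfl

theorem exists_play_position_notMem {Y : Set 𝒜.Position} (hY : 𝒜.controlPre Y ⊆ Y)
    {p : 𝒜.Position} (hp : p ∉ Y) (τ : 𝒜.Strategy) :
    ∃ π : 𝒜.Play, π.start = p.1 ∧ π.ConsistentWith τ ∧ ∀ n, π.position p.2 n ∉ Y := by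
  choose e he hsrc hall hmove using
    fun q : {q // q ∉ Y} × 𝒜.Strategy => exists_allows_move_notMem hY q.1.2 q.2
  let step : {q // q ∉ Y} × 𝒜.Strategy → {q // q ∉ Y} × 𝒜.Strategy :=
    fun q => (⟨move q.1.1 (e q), hmove q⟩, q.2.after (e q) (he q))
  let run : ℕ → {q // q ∉ Y} × 𝒜.Strategy := fun n => step^[n] (⟨p, hp⟩, τ)
  have hrun : ∀ n, run (n + 1) = step (run n) := fun n => Function.iterate_succ_apply' step n _
  let π : 𝒜.Play :=
    { edge := fun n => e (run n)
      edge_mem := fun n => he (run n)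
      edge_link := fun n => by rw [hsrc, hrun]; rfl }
  have hposition : ∀ n, π.position p.2 n = (run n).1.1 := by
    intro n
    induction n with
    | zero => exact Prod.ext (hsrc _) rfl
    | succ n ih => rw [π.position_succ, ih, hrun]
  refine ⟨π, hsrc _, ?_, fun n => ?_⟩
  · exact Play.consistentWith_of_forall_allows (τ := fun n => (run n).2) (fun n => hall (run n))
      fun n => congrArg Prod.snd (hrun n)
  · rw [hposition n]
    exact (run n).1.2

/-- The positions from which player 1 has a winning strategy. -/
def winningRegion (𝒜 : Arena.{u, w} C) : Set 𝒜.Position :=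
  {p | ∃ τ : 𝒜.Strategy, τ.WinningFrom p.1 p.2}

theorem winningRegion_subset_controlPre : 𝒜.winningRegion ⊆ 𝒜.controlPre 𝒜.winningRegion := by
  rintro ⟨x, W⟩ ⟨τ, hτ⟩
  by_cases hx : x ∈ 𝒜.V₁
  · obtain ⟨e, he, rfl, hall⟩ := τ.exists_allows hx
    exact Or.inl ⟨hx, e, he, rfl, _, Strategy.WinningFrom.after hτ he hall⟩
  · refine Or.inr ⟨hx, ?_⟩
    rintro e he rfl
    exact ⟨_, Strategy.WinningFrom.after hτ he fun h => absurd h hx⟩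

variable (𝒜) in
/-- The monotone operator whose least fixed point is the attractor. -/
def attractorStep : Set 𝒜.Position →o Set 𝒜.Position where
  toFun X := {p | p.2 = Set.univ} ∪ 𝒜.controlPre X
  monotone' _ _ h := Set.union_subset_union_right _ (𝒜.controlPre.mono h)

variable (𝒜) in
/-- The positions from which player 1 can force a visit to a position whose objective is already
achieved, whatever comes next. -/
def attractor : Set 𝒜.Position :=
  𝒜.attractorStep.lfp

theorem mem_attractor_of_eq_univ {p : 𝒜.Position} (hp : p.2 = Set.univ) : p ∈ 𝒜.attractor := by
  rw [attractor, ← OrderHom.map_lfp]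
  exact Or.inl hp

theorem controlPre_attractor_subset : 𝒜.controlPre 𝒜.attractor ⊆ 𝒜.attractor := by
  intro p hp
  rw [attractor, ← OrderHom.map_lfp]
  exact Or.inr hp

theorem mem_controlPre_lfpRank_lt {p : 𝒜.Position} (hp : p ∈ 𝒜.attractor)
    (huniv : p.2 ≠ Set.univ) :
    p ∈ 𝒜.controlPre
      {q ∈ 𝒜.attractor | lfpRank 𝒜.attractorStep q < lfpRank 𝒜.attractorStep p} :=
  (mem_map_lfpRank_lt _ hp).resolve_left huniv

theorem mem_attractor_of_mem_winningRegion {p : 𝒜.Position} (hp : p ∈ 𝒜.winningRegion)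
    (hreach : ∀ x ∈ p.2, ∃ n, residual p.2 (wordPrefix x n) = Set.univ) : p ∈ 𝒜.attractor := by
  by_contra hattr
  obtain ⟨τ, hτ⟩ := hp
  obtain ⟨π, hstart, hcons, hpos⟩ :=
    exists_play_position_notMem controlPre_attractor_subset hattr τ
  obtain ⟨n, hn⟩ := hreach _ (hτ π hstart hcons)
  exact hpos n (mem_attractor_of_eq_univ hn)

variable (𝒜) in
/-- The positions that player 1 aims to stay in. -/
def safeRegion : Set 𝒜.Position :=
  𝒜.attractor ∪ 𝒜.winningRegion

/-- The positions in the safe region which, as successors of `p`, make progress in the attractor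
as long as the objective is not achieved. -/
def progressRegion (p : 𝒜.Position) : Set 𝒜.Position :=
  {q ∈ 𝒜.safeRegion | p ∈ 𝒜.attractor → p.2 ≠ Set.univ →
    q ∈ 𝒜.attractor ∧ lfpRank 𝒜.attractorStep q < lfpRank 𝒜.attractorStep p}

theorem mem_controlPre_of_eq_univ {p : 𝒜.Position} (hp : p.2 = Set.univ) :
    p ∈ 𝒜.controlPre {q | q.2 = Set.univ} := by
  have hmove : ∀ e, (move p e).2 = Set.univ := fun e => by rw [move, hp, residual_univ]
  by_cases hV : p.1 ∈ 𝒜.V₁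
  · obtain ⟨e, he, hsrc⟩ := 𝒜.exists_edge p.1 hV
    exact Or.inl ⟨hV, e, he, hsrc, hmove e⟩
  · exact Or.inr ⟨hV, fun e _ _ => hmove e⟩

theorem mem_controlPre_progressRegion {p : 𝒜.Position} (hp : p ∈ 𝒜.safeRegion) :
    p ∈ 𝒜.controlPre (progressRegion p) := by
  by_cases huniv : p.2 = Set.univ
  · refine 𝒜.controlPre.mono (fun q hq => ?_) (mem_controlPre_of_eq_univ huniv)
    exact ⟨Or.inl (mem_attractor_of_eq_univ hq), fun _ h => absurd huniv h⟩
  by_cases hattr : p ∈ 𝒜.attractor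
  · refine 𝒜.controlPre.mono (fun q hq => ?_) (mem_controlPre_lfpRank_lt hattr huniv)
    exact ⟨Or.inl hq.1, fun _ _ => hq⟩
  · refine 𝒜.controlPre.mono (fun q hq => ?_)
      (winningRegion_subset_controlPre (hp.resolve_left hattr))
    exact ⟨Or.inr hq, fun h => absurd h hattr⟩

end Positions

end Arena

section Sufficiency

variable {C : Type u} {M : Type v} {ℳ : MemoryStructure C M} {W : Set (ℕ → C)}

theorem MemoryStructure.updStar_append (ℳ : MemoryStructure C M) (m : M) (w₁ w₂ : List C) :
    ℳ.updStar m (w₁ ++ w₂) = ℳ.updStar (ℳ.updStar m w₁) w₂ :=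
  List.foldl_append

/-- The residuals of `W` by the words that lead to the memory state `m`. -/
def MemoryStructure.residualsAt (ℳ : MemoryStructure C M) (W : Set (ℕ → C)) (m : M) :
    Set (Set (ℕ → C)) :=
  {R | ∃ u, ℳ.updStar ℳ.init u = m ∧ residual W u = R}

/-- Strong monotony of `W` with respect to `ℳ`: the residuals of `W` by words that lead to the
same memory state are comparable. -/
def MemoryStructure.StronglyMonotone (ℳ : MemoryStructure C M) (W : Set (ℕ → C)) : Prop :=
  ∀ m, IsChain (· ⊆ ·) (ℳ.residualsAt W m)

/-- Progress consistency of `W` with respect to `ℳ`: if reading `w` is a loop of `ℳ` that strictly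
improves the residual reached, then repeating it forever is winning. -/
def MemoryStructure.ProgressConsistent (ℳ : MemoryStructure C M) (W : Set (ℕ → C)) : Prop :=
  ∀ u w : List C, ℳ.updStar ℳ.init (u ++ w) = ℳ.updStar ℳ.init u →
    residual W u ⊂ residual W (u ++ w) → ∀ x, prepend w x = x → x ∈ residual W u

theorem MemoryStructure.residual_mem_residualsAt {m : M} {R : Set (ℕ → C)}
    (hR : R ∈ ℳ.residualsAt W m) (w : List C) :
    residual R w ∈ ℳ.residualsAt W (ℳ.updStar m w) := by
  obtain ⟨u, rfl, rfl⟩ := hR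
  exact ⟨u ++ w, ℳ.updStar_append _ u w, residual_append W u w⟩

theorem isLeast_sInter_of_isChain {α : Type u} {D : Set (Set α)} (hD : D.Finite)
    (hne : D.Nonempty) (hchain : IsChain (· ⊆ ·) D) : IsLeast D (⋂₀ D) := by
  obtain ⟨S, hS, hmin⟩ := hD.exists_minimal hne
  have hleast : IsLeast D S :=
    ⟨hS, fun R hR => (hchain.total hS hR).elim id fun h => hmin hR h⟩
  have heq : ⋂₀ D = S := hleast.isGLB.sInf_eq
  rwa [heq]

open Arena

/-- The sequence `S` of residuals of `W` accompanies the play `π`: it is an underestimation of the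
objective that remains to be achieved, among the residuals possible in the current memory state,
and from each position `(v, S n)` the play makes progress. -/
structure Accompanies {𝒜 : Arena.{u, w} C} (ℳ : MemoryStructure C M) (W : Set (ℕ → C))
    (π : 𝒜.Play) (S : ℕ → Set (ℕ → C)) : Prop where
  zero_subset : S 0 ⊆ W
  succ_subset : ∀ n, S (n + 1) ⊆ residual (S n) [π.colors n]
  mem_residualsAt : ∀ n, S n ∈ ℳ.residualsAt W (ℳ.updStar ℳ.init (wordPrefix π.colors n))
  mem_safeRegion : ∀ n, ((π.edge n).1, S n) ∈ 𝒜.safeRegion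
  move_mem : ∀ n, move ((π.edge n).1, S n) (π.edge n) ∈ progressRegion ((π.edge n).1, S n)

/-- The intersection of the objectives `R` which are possible in the memory state `m` and for which
the position `(x, R)` is in the safe region. -/
def leastObjective {𝒜 : Arena.{u, w} C} (ℳ : MemoryStructure C M) (W : Set (ℕ → C))
    (x : 𝒜.V) (m : M) : Set (ℕ → C) :=
  ⋂₀ {R ∈ ℳ.residualsAt W m | (x, R) ∈ 𝒜.safeRegion}

theorem MemoryStructure.StronglyMonotone.isLeast_leastObjective {𝒜 : Arena.{u, w} C}
    (hmono : ℳ.StronglyMonotone W) (hfin : (Set.range (residual W)).Finite)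
    {x : 𝒜.V} {m : M} {R : Set (ℕ → C)} (hR : R ∈ ℳ.residualsAt W m)
    (hsafe : (x, R) ∈ 𝒜.safeRegion) :
    IsLeast {R ∈ ℳ.residualsAt W m | (x, R) ∈ 𝒜.safeRegion} (leastObjective ℳ W x m) := by
  refine isLeast_sInter_of_isChain (hfin.subset ?_) ⟨R, hR, hsafe⟩
    ((hmono m).mono (Set.sep_subset _ _))
  rintro _ ⟨⟨u, -, rfl⟩, -⟩
  exact Set.mem_range_self u

theorem exists_basedOn_forall_move_mem {𝒜 : Arena.{u, w} C} (ℳ : MemoryStructure C M)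
    (S : 𝒜.V → M → Set (ℕ → C)) (T : 𝒜.Position → Set 𝒜.Position) :
    ∃ σ : 𝒜.Strategy, σ.BasedOn ℳ ∧ ∀ π : 𝒜.Play, π.ConsistentWith σ → ∀ n p,
      p = ((π.edge n).1, S (π.edge n).1 (ℳ.updStar ℳ.init (wordPrefix π.colors n))) →
      p ∈ 𝒜.controlPre (T p) → move p (π.edge n) ∈ T p := by
  have hedge : ∀ (x : 𝒜.V₁) (m : M), ∃ e : 𝒜.E, e.1.1 = x ∧
      ∀ p, p = (x.1, S x m) → p ∈ 𝒜.controlPre (T p) → move p e ∈ T p := by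
    rintro ⟨x, hx⟩ m
    by_cases hp : (x, S x m) ∈ 𝒜.controlPre (T (x, S x m))
    · obtain ⟨-, e, he, hsrc, hmove⟩ := hp.resolve_right fun h => h.1 hx
      exact ⟨⟨e, he⟩, hsrc, by rintro _ rfl _; exact hmove⟩
    · obtain ⟨e, he, hsrc⟩ := 𝒜.exists_edge x hx
      exact ⟨⟨e, he⟩, hsrc, by rintro _ rfl h; exact absurd h hp⟩
  choose nxt hsrc hmove using hedge
  refine ⟨⟨fun γ => nxt ⟨γ.1.out, γ.2⟩ (ℳ.updStar ℳ.init γ.1.colors), fun γ => hsrc _ _⟩,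
    ⟨nxt, fun γ => rfl⟩, fun π hπ n p hp hctrl => ?_⟩
  by_cases hV : (π.edge n).1 ∈ 𝒜.V₁
  · have hn := hπ n (by rwa [π.out_take])
    rw [← hn]
    refine hmove _ _ p ?_ hctrl
    simpa only [π.out_take, π.colors_take] using hp
  · subst hp
    exact (hctrl.resolve_left fun h => hV h.1).2 _ (π.edge_mem n) rfl

/-- Player 1 plays as if the objective were the least one that is possible in the current memory
state and keeps the position safe. -/
theorem MemoryStructure.StronglyMonotone.exists_basedOn_accompanies (𝒜 : Arena.{u, w} C)
    (hmono : ℳ.StronglyMonotone W) (hfin : (Set.range (residual W)).Finite) :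
    ∃ σ : 𝒜.Strategy, σ.BasedOn ℳ ∧ ∀ π : 𝒜.Play, π.ConsistentWith σ →
      (π.start, W) ∈ 𝒜.winningRegion → ∃ S, Accompanies ℳ W π S := by
  obtain ⟨σ, hbased, hσ⟩ :=
    exists_basedOn_forall_move_mem ℳ (leastObjective (𝒜 := 𝒜) ℳ W) progressRegion
  refine ⟨σ, hbased, fun π hπ hstart => ?_⟩
  let state : ℕ → M := fun n => ℳ.updStar ℳ.init (wordPrefix π.colors n)
  let candidates : ℕ → Set (Set (ℕ → C)) := fun n =>
    {R ∈ ℳ.residualsAt W (state n) | ((π.edge n).1, R) ∈ 𝒜.safeRegion}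
  let S : ℕ → Set (ℕ → C) := fun n => leastObjective ℳ W (π.edge n).1 (state n)
  have hleast : ∀ n R, R ∈ candidates n → IsLeast (candidates n) (S n) :=
    fun n R hR => hmono.isLeast_leastObjective hfin hR.1 hR.2
  have hmove : ∀ n, S n ∈ candidates n →
      move ((π.edge n).1, S n) (π.edge n) ∈ progressRegion ((π.edge n).1, S n) :=
    fun n hn => hσ π hπ n _ rfl (mem_controlPre_progressRegion hn.2)
  have hnext : ∀ n, S n ∈ candidates n → residual (S n) [π.colors n] ∈ candidates (n + 1) := by
    intro n hn
    constructor
    · change _ ∈ ℳ.residualsAt W (ℳ.updStar _ _)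
      rw [wordPrefix_succ, ℳ.updStar_append]
      exact MemoryStructure.residual_mem_residualsAt hn.1 _
    · rw [← π.edge_link]
      exact (hmove n hn).1
  have hW : W ∈ candidates 0 := ⟨⟨[], rfl, rfl⟩, Or.inr hstart⟩
  have hS : ∀ n, S n ∈ candidates n := by
    intro n
    induction n with
    | zero => exact (hleast 0 W hW).1
    | succ n ih => exact (hleast (n + 1) _ (hnext n ih)).1
  exact ⟨S, (hleast 0 W hW).2 hW, fun n => (hleast (n + 1) _ (hnext n (hS n))).2 (hnext n (hS n)),
    fun n => (hS n).1, fun n => (hS n).2, fun n => hmove n (hS n)⟩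

section Accompanies

variable {𝒜 : Arena.{u, w} C} {π : 𝒜.Play} {S : ℕ → Set (ℕ → C)}

theorem Accompanies.add_subset_residual (h : Accompanies ℳ W π S) (m n : ℕ) :
    S (m + n) ⊆ residual (S m) (wordPrefix (wordSuffix π.colors m) n) := by
  induction n with
  | zero => rfl
  | succ n ih =>
    rw [wordPrefix_succ, residual_append, wordSuffix_apply]
    exact (h.succ_subset (m + n)).trans (residual_mono ih _)

theorem Accompanies.subset_residual (h : Accompanies ℳ W π S) (n : ℕ) :
    S n ⊆ residual W (wordPrefix π.colors n) := by
  have hn := h.add_subset_residual 0 n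
  rw [Nat.zero_add, wordSuffix_zero] at hn
  exact hn.trans (residual_mono h.zero_subset _)

theorem Accompanies.ne_univ (h : Accompanies ℳ W π S) (hπ : π.colors ∉ W) (n : ℕ) :
    S n ≠ Set.univ := by
  intro huniv
  have hn := h.subset_residual n
  rw [huniv] at hn
  exact hπ ((wordSuffix_mem_residual_wordPrefix n).1 (hn trivial))

/-- If the underestimation were exact from stage `N` on, then the rank in the attractor would
decrease forever. -/
theorem Accompanies.exists_ssubset (h : Accompanies ℳ W π S) {N : ℕ}
    (hattr : ∀ n ≥ N, ((π.edge n).1, S n) ∈ 𝒜.attractor) (huniv : ∀ n ≥ N, S n ≠ Set.univ) :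
    ∃ n ≥ N, S (n + 1) ⊂ residual (S n) [π.colors n] := by
  by_contra! hnot
  have heq : ∀ n ≥ N, S (n + 1) = residual (S n) [π.colors n] := fun n hn =>
    (h.succ_subset n).eq_of_not_ssubset (hnot n hn)
  refine not_strictAnti_of_wellFoundedLT
    (fun k => lfpRank 𝒜.attractorStep ((π.edge (N + k)).1, S (N + k))) ?_
  refine strictAnti_nat_of_succ_lt fun k => ?_
  have hk : N ≤ N + k := Nat.le_add_right N k
  have hpos : ((π.edge (N + k + 1)).1, S (N + k + 1)) =
      move ((π.edge (N + k)).1, S (N + k)) (π.edge (N + k)) := by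
    rw [heq _ hk, ← π.edge_link]
    rfl
  rw [← Nat.add_assoc, hpos]
  exact ((h.move_mem (N + k)).2 (hattr _ hk) (huniv _ hk)).2

theorem Accompanies.colors_mem_of_isRegularReach_compl (h : Accompanies ℳ W π S)
    (hW : IsRegularReach Wᶜ) : π.colors ∈ W := by
  by_contra hπ
  obtain ⟨N, hN⟩ := hW.exists_residual_eq_univ _ hπ
  have hempty : ∀ n ≥ N, S n = ∅ := by
    intro n hn
    have hsub := h.subset_residual n
    have hres := residual_wordPrefix_eq_univ_of_le hn hN
    rw [residual_compl, Set.compl_univ_iff] at hres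
    rwa [hres, Set.subset_empty_iff] at hsub
  have hattr : ∀ n ≥ N, ((π.edge n).1, S n) ∈ 𝒜.attractor := by
    intro n hn
    refine (h.mem_safeRegion n).elim id fun hwin => mem_attractor_of_mem_winningRegion hwin ?_
    rw [hempty n hn]
    exact fun x hx => hx.elim
  obtain ⟨n, hn, hlt⟩ := h.exists_ssubset hattr fun n _ => h.ne_univ hπ n
  rw [hempty n hn, residual_empty] at hlt
  exact hlt.not_subset (Set.empty_subset _)

theorem Accompanies.mem_residual_of_prepend_eq_self (h : Accompanies ℳ W π S)
    (hprog : ℳ.ProgressConsistent W) {i j : ℕ} (hij : i ≤ j)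
    (hstate : ℳ.updStar ℳ.init (wordPrefix π.colors (j + 1)) =
      ℳ.updStar ℳ.init (wordPrefix π.colors i))
    (hS : S (j + 1) = S i) (hlt : S (j + 1) ⊂ residual (S j) [π.colors j]) {x : ℕ → C}
    (hx : prepend (wordPrefix (wordSuffix π.colors i) (j + 1 - i)) x = x) :
    x ∈ residual W (wordPrefix π.colors i) := by
  obtain ⟨k, rfl⟩ := Nat.exists_eq_add_of_le hij
  rw [Nat.add_assoc, Nat.add_sub_cancel_left] at hx
  obtain ⟨u, hu, hres⟩ := h.mem_residualsAt i
  have hloop : ℳ.updStar ℳ.init (u ++ wordPrefix (wordSuffix π.colors i) (k + 1)) =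
      ℳ.updStar ℳ.init u := by
    rw [ℳ.updStar_append, hu, ← ℳ.updStar_append, ← wordPrefix_add]
    exact hstate
  have hlt' : S i ⊂ residual (S i) (wordPrefix (wordSuffix π.colors i) (k + 1)) := by
    rw [wordPrefix_succ, residual_append, wordSuffix_apply, ← hS]
    refine hlt.trans_subset (residual_mono ?_ _)
    rw [hS]
    exact h.add_subset_residual i k
  refine h.subset_residual i ?_
  rw [← hres]
  refine hprog u _ hloop ?_ x hx
  rwa [residual_append, hres]

theorem Accompanies.mem_attractor_of_isRegularReach (h : Accompanies ℳ W π S)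
    (hW : IsRegularReach W) (n : ℕ) : ((π.edge n).1, S n) ∈ 𝒜.attractor := by
  obtain ⟨u, -, hu⟩ := h.mem_residualsAt n
  refine (h.mem_safeRegion n).elim id fun hwin => mem_attractor_of_mem_winningRegion hwin ?_
  rw [← hu]
  exact (hW.residual u).exists_residual_eq_univ

theorem Accompanies.exists_lt_ssubset_of_finite [Finite M] (h : Accompanies ℳ W π S)
    (hfin : (Set.range (residual W)).Finite)
    (hinf : {n | S (n + 1) ⊂ residual (S n) [π.colors n]}.Infinite) :
    ∃ i j, i < j ∧ S (j + 1) ⊂ residual (S j) [π.colors j] ∧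
      ℳ.updStar ℳ.init (wordPrefix π.colors (j + 1)) =
        ℳ.updStar ℳ.init (wordPrefix π.colors (i + 1)) ∧
      S (j + 1) = S (i + 1) ∧
      residual W (wordPrefix π.colors (j + 1)) = residual W (wordPrefix π.colors (i + 1)) := by
  let summary : ℕ → M × Set (ℕ → C) × Set (ℕ → C) := fun n =>
    (ℳ.updStar ℳ.init (wordPrefix π.colors (n + 1)), S (n + 1),
      residual W (wordPrefix π.colors (n + 1)))
  have hmaps : Set.MapsTo summary {n | S (n + 1) ⊂ residual (S n) [π.colors n]}
      (Set.univ ×ˢ Set.range (residual W) ×ˢ Set.range (residual W)) := by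
    intro n _
    obtain ⟨u, -, hu⟩ := h.mem_residualsAt (n + 1)
    exact ⟨trivial, ⟨u, hu⟩, Set.mem_range_self _⟩
  obtain ⟨i, -, j, hj, hij, heq⟩ := hinf.exists_lt_map_eq_of_mapsTo hmaps
    (Set.finite_univ.prod (hfin.prod hfin))
  simp only [summary, Prod.mk.injEq] at heq
  exact ⟨i, j, hij, hj, heq.1.symm, heq.2.1.symm, heq.2.2.symm⟩

theorem Accompanies.colors_mem_of_isRegularReach [Finite M] (h : Accompanies ℳ W π S)
    (hW : IsRegularReach W) (hprog : ℳ.ProgressConsistent W) : π.colors ∈ W := by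
  by_contra hπ
  have hinf : {n | S (n + 1) ⊂ residual (S n) [π.colors n]}.Infinite :=
    Nat.frequently_atTop_iff_infinite.1 <| Filter.frequently_atTop.2 fun N =>
      h.exists_ssubset (fun n _ => h.mem_attractor_of_isRegularReach hW n)
        fun n _ => h.ne_univ hπ n
  obtain ⟨i, j, hij, hlt, hstate, hS, hres⟩ :=
    h.exists_lt_ssubset_of_finite hW.finite_residuals hinf
  set t := wordPrefix (wordSuffix π.colors (i + 1)) (j + 1 - (i + 1))
  have ht : t ≠ [] := by
    rw [← List.length_pos_iff, length_wordPrefix]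
    omega
  obtain ⟨x, hx⟩ := exists_prepend_eq_self ht
  have hloop : residual (residual W (wordPrefix π.colors (i + 1))) t =
      residual W (wordPrefix π.colors (i + 1)) := by
    rwa [← residual_append, ← wordPrefix_add, Nat.add_sub_cancel' (by omega)]
  have huniv := (hW.residual _).eq_univ_of_residual_eq_self ht hloop hx
    (h.mem_residual_of_prepend_eq_self hprog hij hstate hS hlt hx)
  rw [← wordSuffix_mem_residual_wordPrefix (i + 1), huniv] at hπ
  exact hπ trivial

end Accompanies

theorem MemoryStructure.StronglyMonotone.sufficesIn (hmono : ℳ.StronglyMonotone W)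
    (hfin : (Set.range (residual W)).Finite) {𝒜 : Arena.{u, w} C}
    (hcolors : ∀ (π : 𝒜.Play) (S : ℕ → Set (ℕ → C)), Accompanies ℳ W π S → π.colors ∈ W) :
    ℳ.SufficesIn W 𝒜 := by
  obtain ⟨σ, hbased, hσ⟩ := hmono.exists_basedOn_accompanies 𝒜 hfin
  refine ⟨σ, hbased, ?_⟩
  rintro _ hwin π rfl hπ
  obtain ⟨S, hS⟩ := hσ π hπ hwin
  exact hcolors π S hS

theorem MemoryStructure.StronglyMonotone.sufficesIn_of_isRegularReach_compl
    (hmono : ℳ.StronglyMonotone W) (hW : IsRegularReach Wᶜ) (𝒜 : Arena.{u, w} C) :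
    ℳ.SufficesIn W 𝒜 := by
  refine hmono.sufficesIn ?_ fun _ _ hS => hS.colors_mem_of_isRegularReach_compl hW
  rw [← compl_compl W]
  exact hW.finite_residuals_compl

theorem MemoryStructure.StronglyMonotone.sufficesIn_of_isRegularReach [Finite M]
    (hmono : ℳ.StronglyMonotone W) (hprog : ℳ.ProgressConsistent W) (hW : IsRegularReach W)
    (𝒜 : Arena.{u, w} C) : ℳ.SufficesIn W 𝒜 :=
  hmono.sufficesIn hW.finite_residuals fun _ _ hS => hS.colors_mem_of_isRegularReach hW hprog

end Sufficiency

namespace Arena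

variable {C : Type u} {𝒜 : Arena.{u, w} C}

section OnePlayer

theorem IsOnePlayer.mem_V₁ (h𝒜 : 𝒜.IsOnePlayer) (x : 𝒜.V) : x ∈ 𝒜.V₁ :=
  Set.notMem_compl_iff.1 fun hx => (Set.eq_empty_iff_forall_notMem.1 h𝒜 x hx).elim

theorem IsOnePlayer.exists_play_consistentWith (h𝒜 : 𝒜.IsOnePlayer) (x : 𝒜.V) (τ : 𝒜.Strategy) :
    ∃ π : 𝒜.Play, π.start = x ∧ π.ConsistentWith τ := by
  have hdead : 𝒜.controlPre ∅ ⊆ ∅ := by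
    rintro p (⟨-, e, -, -, hmem⟩ | ⟨hp, -⟩)
    · exact hmem
    · exact hp (h𝒜.mem_V₁ p.1)
  obtain ⟨π, hstart, hcons, -⟩ :=
    exists_play_position_notMem hdead (Set.notMem_empty (x, Set.univ)) τ
  exact ⟨π, hstart, hcons⟩

open Classical in
/-- The strategy that takes the edges of the play `π` as long as the history is a prefix of `π`. -/
noncomputable def Strategy.follow (π : 𝒜.Play) : 𝒜.Strategy where
  next γ :=
    if γ.1 = π.take γ.1.edges.length then ⟨π.edge γ.1.edges.length, π.edge_mem _⟩
    else ⟨(𝒜.exists_edge γ.1.out γ.2).choose, (𝒜.exists_edge γ.1.out γ.2).choose_spec.1⟩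
  next_in γ := by
    split_ifs with hγ
    · rw [hγ, π.out_take, Play.take, length_wordPrefix]
    · exact (𝒜.exists_edge γ.1.out γ.2).choose_spec.2

theorem Strategy.next_follow_take (π : 𝒜.Play) (n : ℕ) (h : (π.take n).out ∈ 𝒜.V₁) :
    ((Strategy.follow π).next ⟨π.take n, h⟩).1 = π.edge n := by
  have hlen : (π.take n).edges.length = n := length_wordPrefix _ _
  simp only [Strategy.follow, hlen, if_true]

theorem IsOnePlayer.edge_eq_of_consistentWith_follow (h𝒜 : 𝒜.IsOnePlayer) {π π' : 𝒜.Play}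
    (hstart : π'.start = π.start) (hcons : π'.ConsistentWith (Strategy.follow π)) (n : ℕ) :
    π'.edge n = π.edge n := by
  induction n using Nat.strong_induction_on with
  | _ n ih =>
    have hedges : wordPrefix π'.edge n = wordPrefix π.edge n :=
      wordPrefix_inj.2 ih
    have htake : π'.take n = π.take n := (History.mk.injEq ..).mpr ⟨hstart, hedges⟩
    rw [← hcons n (h𝒜.mem_V₁ _), ← Strategy.next_follow_take π n (h𝒜.mem_V₁ _)]
    simp only [htake]

theorem IsOnePlayer.winningFrom_follow (h𝒜 : 𝒜.IsOnePlayer) {π : 𝒜.Play} {W : Set (ℕ → C)}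
    (hπ : π.colors ∈ W) : (Strategy.follow π).WinningFrom π.start W := by
  intro π' hstart hcons
  have hcolors : π'.colors = π.colors := funext fun n => by
    rw [Play.colors, Play.colors, h𝒜.edge_eq_of_consistentWith_follow hstart hcons]
  rwa [hcolors]

end OnePlayer

end Arena

section Runs

variable {C : Type u} {M : Type v} {ℳ : MemoryStructure C M} {W : Set (ℕ → C)}

open Arena

theorem MemoryStructure.SufficesIn.exists_next_of_isOnePlayer {𝒜 : Arena.{u, w} C}
    (h : ℳ.SufficesIn W 𝒜) (h𝒜 : 𝒜.IsOnePlayer) :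
    ∃ nxt : 𝒜.V → M → 𝒜.V × C × 𝒜.V, ∀ π : 𝒜.Play, π.colors ∈ W →
      ∃ π' : 𝒜.Play, π'.start = π.start ∧ π'.colors ∈ W ∧
        ∀ n, π'.edge n = nxt (π'.edge n).1 (ℳ.updStar ℳ.init (wordPrefix π'.colors n)) := by
  obtain ⟨σ, ⟨nxt, hnxt⟩, hopt⟩ := h
  refine ⟨fun x m => (nxt ⟨x, h𝒜.mem_V₁ x⟩ m).1, fun π hπ => ?_⟩
  obtain ⟨π', hstart, hcons⟩ := h𝒜.exists_play_consistentWith π.start σ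
  refine ⟨π', hstart, hopt _ ⟨_, h𝒜.winningFrom_follow hπ⟩ π' hstart hcons, fun n => ?_⟩
  have hn := hcons n (h𝒜.mem_V₁ _)
  rw [hnxt] at hn
  simpa only [π'.out_take, π'.colors_take] using hn.symm

/-- `s` is an infinite run, with labels `x`, of the transition system on `Q` in which a state `q`
has the labelled successors `δ q`. -/
def IsRun {Q : Type u} (δ : Q → Set (C × Q)) (s : ℕ → Q) (x : ℕ → C) : Prop :=
  ∀ n, (x n, s (n + 1)) ∈ δ (s n)

/-- The one-player arena whose vertices name, through `ι`, states of the transition system `δ`. The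
vertices have a type of their own since the universe of the vertices is prescribed. -/
def runArena {Q : Type u} {V : Type w} [Nonempty V] (δ : Q → Set (C × Q)) (ι : V → Q)
    (hδ : ∀ x, ∃ a y, (a, ι y) ∈ δ (ι x)) : Arena.{u, w} C where
  V := V
  nonempty := inferInstance
  V₁ := Set.univ
  E := {e | (e.2.1, ι e.2.2) ∈ δ (ι e.1)}
  exists_edge x _ := by
    obtain ⟨a, y, h⟩ := hδ x
    exact ⟨(x, a, y), h, rfl⟩

section RunArena

variable {Q : Type u} {V : Type w} [Nonempty V] {δ : Q → Set (C × Q)} {ι : V → Q}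
  (hδ : ∀ x, ∃ a y, (a, ι y) ∈ δ (ι x))

theorem runArena_isOnePlayer : (runArena δ ι hδ).IsOnePlayer :=
  Set.compl_univ

theorem runArena_isFinite [Finite V] (hι : ι.Injective) (hfin : ∀ x, (δ (ι x)).Finite) :
    (runArena δ ι hδ).IsFinite := by
  refine ⟨‹Finite V›, ?_⟩
  let f : V × C × V → V × C × Q := fun e => (e.1, e.2.1, ι e.2.2)
  have hf : f.Injective := Function.injective_id.prodMap (Function.injective_id.prodMap hι)
  refine ((Set.finite_univ.prod (Set.finite_iUnion hfin)).preimage hf.injOn).subset ?_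
  exact fun e he => ⟨trivial, Set.mem_iUnion.2 ⟨e.1, he⟩⟩

theorem exists_runArena_play {s : ℕ → Q} {x : ℕ → C} (hrun : IsRun δ s x)
    (hs : ∀ n, s n ∈ Set.range ι) :
    ∃ π : (runArena δ ι hδ).Play, ι π.start = s 0 ∧ π.colors = x := by
  choose vertex hvertex using hs
  refine ⟨⟨fun n => (vertex n, x n, vertex (n + 1)), fun n => ?_, fun n => rfl⟩, hvertex 0, rfl⟩
  change (x n, ι (vertex (n + 1))) ∈ δ (ι (vertex n))
  rw [hvertex, hvertex]
  exact hrun n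

theorem Arena.Play.isRun_runArena (π : (runArena δ ι hδ).Play) :
    IsRun δ (fun n => ι (π.edge n).1) π.colors := by
  intro n
  have hn : (π.colors n, ι (π.edge n).2.2) ∈ δ (ι (π.edge n).1) := π.edge_mem n
  rwa [π.edge_link] at hn

end RunArena

theorem IsRun.mem_of_forall_mem {Q : Type u} {δ : Q → Set (C × Q)} {S : Set Q}
    (hclosed : ∀ q ∈ S, ∀ p ∈ δ q, p.2 ∈ S) {s : ℕ → Q} {x : ℕ → C} (hrun : IsRun δ s x)
    (h0 : s 0 ∈ S) (n : ℕ) : s n ∈ S := by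
  induction n with
  | zero => exact h0
  | succ n ih => exact hclosed _ ih _ (hrun n)

/-- When the steps are chosen by `nxt` from the current state and the memory state, there is a
winning run from each state of `S` from which there is one at all. -/
def IsOptimalChoice {Q : Type u} (ℳ : MemoryStructure C M) (W : Set (ℕ → C))
    (δ : Q → Set (C × Q)) (S : Set Q) (nxt : Q → M → C × Q) : Prop :=
  ∀ s₀ x₀, IsRun δ s₀ x₀ → s₀ 0 ∈ S → x₀ ∈ W →
    ∃ s x, IsRun δ s x ∧ s 0 = s₀ 0 ∧ x ∈ W ∧
      ∀ n, (x n, s (n + 1)) = nxt (s n) (ℳ.updStar ℳ.init (wordPrefix x n))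

theorem exists_isOptimalChoice_of_injective {Q : Type u} {δ : Q → Set (C × Q)} {V : Type w}
    [Finite V] [Nonempty V] {ι : V → Q} (hι : ι.Injective)
    (hsuff : ∀ 𝒜 : Arena.{u, w} C, 𝒜.IsFinite → 𝒜.IsOnePlayer → ℳ.SufficesIn W 𝒜)
    (hclosed : ∀ q ∈ Set.range ι, ∀ p ∈ δ q, p.2 ∈ Set.range ι)
    (hfin : ∀ q ∈ Set.range ι, (δ q).Finite) (hδ : ∀ q ∈ Set.range ι, (δ q).Nonempty) :
    ∃ nxt : Q → M → C × Q, IsOptimalChoice ℳ W δ (Set.range ι) nxt := by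
  have hδι : ∀ x, ∃ a y, (a, ι y) ∈ δ (ι x) := by
    intro x
    obtain ⟨⟨a, q⟩, hp⟩ := hδ _ ⟨x, rfl⟩
    obtain ⟨y, rfl⟩ := hclosed _ ⟨x, rfl⟩ _ hp
    exact ⟨a, y, hp⟩
  have hone := runArena_isOnePlayer hδι
  obtain ⟨nxt, hnxt⟩ := (hsuff (runArena δ ι hδι)
    (runArena_isFinite hδι hι fun x => hfin _ ⟨x, rfl⟩) hone).exists_next_of_isOnePlayer hone
  refine ⟨fun q m => ((nxt (ι.invFun q) m).2.1, ι (nxt (ι.invFun q) m).2.2),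
    fun s₀ x₀ hrun h0 hx₀ => ?_⟩
  obtain ⟨π₀, hstart₀, rfl⟩ := exists_runArena_play hδι hrun (hrun.mem_of_forall_mem hclosed h0)
  obtain ⟨π, hstart, hπ, hnext⟩ := hnxt π₀ hx₀
  refine ⟨_, _, π.isRun_runArena hδι, (congrArg ι hstart).trans hstart₀, hπ, fun n => ?_⟩
  have hinv : ι.invFun (ι (π.edge n).1) = (π.edge n).1 := Function.leftInverse_invFun hι _
  beta_reduce
  rw [hinv, ← hnext n, π.edge_link]
  rfl

theorem exists_isOptimalChoice_of_finite {Q : Type u} {δ : Q → Set (C × Q)} {S : Set Q}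
    (hsuff : ∀ 𝒜 : Arena.{u, w} C, 𝒜.IsFinite → 𝒜.IsOnePlayer → ℳ.SufficesIn W 𝒜)
    (hS : S.Finite) (hne : S.Nonempty) (hclosed : ∀ q ∈ S, ∀ p ∈ δ q, p.2 ∈ S)
    (hfin : ∀ q ∈ S, (δ q).Finite) (hδ : ∀ q ∈ S, (δ q).Nonempty) :
    ∃ nxt : Q → M → C × Q, IsOptimalChoice ℳ W δ S nxt := by
  have : Finite S := hS
  have : Nonempty S := hne.to_subtype
  have : Small.{w} S := Countable.toSmall S
  have : Nonempty (Shrink.{w} S) := (equivShrink S).symm.nonempty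
  let ι : Shrink.{w} S → Q := fun x => (equivShrink S).symm x
  have hι : ι.Injective := Subtype.val_injective.comp (equivShrink S).symm.injective
  have hrange : Set.range ι = S :=
    ((equivShrink S).symm.surjective.range_comp Subtype.val).trans Subtype.range_coe
  have hnext := exists_isOptimalChoice_of_injective (δ := δ) hι hsuff
  rw [hrange] at hnext
  exact hnext hclosed hfin hδ

end Runs

section Necessity

variable {C : Type u} {M : Type v} {ℳ : MemoryStructure C M} {W : Set (ℕ → C)}

/-- A commitment to read the letters of `l` and then be at the hub, or to read `z` forever. -/
inductive Plan (C : Type u) : Type u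
  | toHub (l : List C)
  | forever (z : ℕ → C)

/-- The system that executes plans; the steps in `H` are available at the hub, which is the
plan `toHub []`. -/
def Plan.step (H : Set (C × Plan C)) : Plan C → Set (C × Plan C)
  | toHub [] => H
  | toHub (a :: l) => {(a, toHub l)}
  | forever z => {(z 0, forever (wordSuffix z 1))}

open Plan

/-- The step that leaves the hub in order to read `z` forever. -/
def Plan.leave (z : ℕ → C) : C × Plan C :=
  (z 0, forever (wordSuffix z 1))

section PlanRuns

variable {H : Set (C × Plan C)} {s : ℕ → Plan C} {x : ℕ → C}

theorem IsRun.forever_add (hrun : IsRun (step H) s x) {n : ℕ} {z : ℕ → C}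
    (hn : s n = forever z) (k : ℕ) : s (n + k) = forever (wordSuffix z k) := by
  induction k with
  | zero => exact hn
  | succ k ih =>
    have hstep := hrun (n + k)
    rw [ih] at hstep
    rw [← wordSuffix_wordSuffix]
    exact (Prod.mk.inj hstep).2

theorem IsRun.wordSuffix_of_forever (hrun : IsRun (step H) s x) {n : ℕ} {z : ℕ → C}
    (hn : s n = forever z) : wordSuffix x n = z := by
  funext k
  have hstep := hrun (n + k)
  rw [hrun.forever_add hn] at hstep
  rw [wordSuffix_apply]
  exact (Prod.mk.inj hstep).1.trans (wordSuffix_apply z k 0)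

theorem IsRun.wordPrefix_of_toHub (hrun : IsRun (step H) s x) {n : ℕ} {l : List C}
    (hn : s n = toHub l) :
    s (n + l.length) = toHub [] ∧ wordPrefix x (n + l.length) = wordPrefix x n ++ l := by
  induction l generalizing n with
  | nil => exact ⟨hn, (List.append_nil _).symm⟩
  | cons a l ih =>
    have hstep := hrun n
    rw [hn] at hstep
    obtain ⟨hx, hs⟩ := Prod.mk.inj hstep
    have h := ih hs
    rwa [wordPrefix_succ, hx, List.append_assoc, Nat.add_assoc, Nat.add_comm 1] at h

theorem IsRun.wordPrefix_of_toHub_zero (hrun : IsRun (step H) s x) {l : List C}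
    (h0 : s 0 = toHub l) : s l.length = toHub [] ∧ wordPrefix x l.length = l := by
  have h := hrun.wordPrefix_of_toHub h0
  rwa [Nat.zero_add, wordPrefix_zero, List.nil_append] at h

theorem IsRun.eq_prepend_of_leave (hrun : IsRun (step H) s x) {l : List C} {z : ℕ → C}
    (h0 : s 0 = toHub l) (hz : (x l.length, s (l.length + 1)) = leave z) : x = prepend l z := by
  obtain ⟨hx, hs⟩ := Prod.mk.inj hz
  have hl := (hrun.wordPrefix_of_toHub_zero h0).2
  rw [← prepend_wordPrefix_wordSuffix x (l.length + 1), hrun.wordSuffix_of_forever hs,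
    wordPrefix_succ, hl, hx, prepend_append]
  exact congrArg (prepend l) (prepend_singleton_wordSuffix z)

/-- The word `x` can be read along a run that starts in the plan `q`. -/
def Readable (H : Set (C × Plan C)) (q : Plan C) (x : ℕ → C) : Prop :=
  ∃ s, IsRun (step H) s x ∧ s 0 = q

theorem readable_forever (z : ℕ → C) : Readable H (forever z) z := by
  refine ⟨fun n => forever (wordSuffix z n), fun n => ?_, rfl⟩
  change _ = _
  rw [wordSuffix_wordSuffix, wordSuffix_apply, Nat.add_zero]
  rfl

theorem Readable.cons {q q' : Plan C} {a : C} (hx : Readable H q' x) (h : (a, q') ∈ step H q) :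
    Readable H q (prepend [a] x) := by
  obtain ⟨s, hrun, rfl⟩ := hx
  refine ⟨fun n => n.casesOn q s, ?_, rfl⟩
  rintro (_ | n)
  · exact h
  · exact hrun n

theorem Readable.prepend (hx : Readable H (toHub []) x) (l : List C) :
    Readable H (toHub l) (prepend l x) := by
  induction l with
  | nil => exact hx
  | cons a l ih => exact ih.cons rfl

theorem readable_of_leave_mem {z : ℕ → C} (hz : leave z ∈ H) : Readable H (toHub []) z := by
  rw [← prepend_singleton_wordSuffix z]
  exact (readable_forever (wordSuffix z 1)).cons hz

theorem IsRun.wordPrefix_of_loop (hrun : IsRun (step H) s x) {n : ℕ} {l : List C} {a : C}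
    (hn : (x n, s (n + 1)) = (a, toHub l)) :
    s (n + (a :: l).length) = toHub [] ∧
      wordPrefix x (n + (a :: l).length) = wordPrefix x n ++ a :: l := by
  obtain ⟨hx, hs⟩ := Prod.mk.inj hn
  have h := hrun.wordPrefix_of_toHub hs
  rwa [wordPrefix_succ, hx, List.append_assoc, Nat.add_assoc, Nat.add_comm 1] at h

theorem IsRun.eq_prepend_of_loop (hrun : IsRun (step H) s x) {u l : List C} {a : C}
    (h0 : s 0 = toHub u) (hstate : ℳ.updStar ℳ.init (u ++ a :: l) = ℳ.updStar ℳ.init u)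
    (hchoice : ∀ n, s n = toHub [] →
      ℳ.updStar ℳ.init (wordPrefix x n) = ℳ.updStar ℳ.init u → (x n, s (n + 1)) = (a, toHub l))
    {y : ℕ → C} (hy : prepend (a :: l) y = y) : x = prepend u y := by
  have hloop : ∀ k, s (u.length + k * (a :: l).length) = toHub [] ∧
      ℳ.updStar ℳ.init (wordPrefix x (u.length + k * (a :: l).length)) = ℳ.updStar ℳ.init u ∧
      wordPrefix x (u.length + k * (a :: l).length) =
        wordPrefix (prepend u y) (u.length + k * (a :: l).length) := by
    intro k
    rw [wordPrefix_prepend_length_add]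
    induction k with
    | zero =>
      obtain ⟨hhub, hprefix⟩ := hrun.wordPrefix_of_toHub_zero h0
      rw [Nat.zero_mul, Nat.add_zero, hprefix, wordPrefix_zero, List.append_nil]
      exact ⟨hhub, rfl, rfl⟩
    | succ k ih =>
      obtain ⟨hhub, hm, hprefix⟩ := ih
      obtain ⟨hhub', hprefix'⟩ := hrun.wordPrefix_of_loop (hchoice _ hhub hm)
      rw [wordPrefix_succ_mul_length hy, ← List.append_assoc, ← hprefix, Nat.succ_mul,
        ← Nat.add_assoc, hprefix', ℳ.updStar_append, hm, ← ℳ.updStar_append]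
      exact ⟨hhub', hstate, rfl⟩
  funext n
  refine wordPrefix_inj.1 (hloop (n + 1)).2.2 n ?_
  rw [List.length_cons]
  nlinarith

end PlanRuns

/-- The plans met when executing the plans `toHub w` for `w ∈ L` and `forever z` for `z ∈ Z`. -/
def plans (L : Set (List C)) (Z : Set (ℕ → C)) : Set (Plan C) :=
  toHub '' {l | ∃ w ∈ L, l <:+ w} ∪ forever '' {x | ∃ z ∈ Z, ∃ n, wordSuffix z n = x}

section Plans

variable {L : Set (List C)} {Z : Set (ℕ → C)} {H : Set (C × Plan C)}

theorem toHub_mem_plans {w l : List C} (hw : w ∈ L) (hl : l <:+ w) : toHub l ∈ plans L Z :=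
  Or.inl ⟨l, ⟨w, hw, hl⟩, rfl⟩

theorem forever_mem_plans {z : ℕ → C} (hz : z ∈ Z) (n : ℕ) :
    forever (wordSuffix z n) ∈ plans L Z :=
  Or.inr ⟨_, ⟨z, hz, n, rfl⟩, rfl⟩

theorem finite_plans (hL : L.Finite) (hZ : Z.Finite) (hper : ∀ z ∈ Z, UltimatelyPeriodic z) :
    (plans L Z).Finite := by
  refine Set.Finite.union (Set.Finite.image _ ?_) (Set.Finite.image _ ?_)
  · refine (hL.biUnion fun w _ => w.tails.finite_toSet).subset ?_
    rintro l ⟨w, hw, hl⟩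
    exact Set.mem_biUnion hw ((List.mem_tails l w).2 hl)
  · refine (hZ.biUnion hper).subset ?_
    rintro _ ⟨z, hz, n, rfl⟩
    exact Set.mem_biUnion hz ⟨n, rfl⟩

theorem mem_plans_of_mem_step (hH : ∀ p ∈ H, p.2 ∈ plans L Z) {q : Plan C} (hq : q ∈ plans L Z)
    {p : C × Plan C} (hp : p ∈ step H q) : p.2 ∈ plans L Z := by
  rcases hq with ⟨_ | ⟨a, l⟩, ⟨w, hw, hl⟩, rfl⟩ | ⟨_, ⟨z, hz, n, rfl⟩, rfl⟩
  · exact hH p hp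
  · obtain rfl := hp
    exact toHub_mem_plans hw ((List.suffix_cons a l).trans hl)
  · obtain rfl := hp
    rw [wordSuffix_wordSuffix]
    exact forever_mem_plans hz _

theorem finite_step (hH : H.Finite) (q : Plan C) : (step H q).Finite := by
  rcases q with (_ | ⟨a, l⟩) | z
  exacts [hH, Set.finite_singleton _, Set.finite_singleton _]

theorem nonempty_step (hH : H.Nonempty) (q : Plan C) : (step H q).Nonempty := by
  rcases q with (_ | ⟨a, l⟩) | z
  exacts [hH, Set.singleton_nonempty _, Set.singleton_nonempty _]

end Plans

section HubChoice

variable {H : Set (C × Plan C)} {choice : M → C × Plan C} {u : List C}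

/-- Some run from `toHub u` is winning although the step taken at the hub only depends, through
`choice`, on the memory state. -/
def WinsWith (ℳ : MemoryStructure C M) (W : Set (ℕ → C)) (H : Set (C × Plan C))
    (choice : M → C × Plan C) (u : List C) : Prop :=
  ∃ s x, IsRun (step H) s x ∧ s 0 = toHub u ∧ x ∈ W ∧
    ∀ n, s n = toHub [] → (x n, s (n + 1)) = choice (ℳ.updStar ℳ.init (wordPrefix x n))

/-- The steps chosen at the hub by `choice` win after each word of `L` after which it is possible
to win. -/
def IsHubChoice (ℳ : MemoryStructure C M) (W : Set (ℕ → C)) (H : Set (C × Plan C))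
    (L : Set (List C)) (choice : M → C × Plan C) : Prop :=
  ∀ u ∈ L, ∀ y, Readable H (toHub []) y → y ∈ residual W u → WinsWith ℳ W H choice u

theorem WinsWith.choice_mem (h : WinsWith ℳ W H choice u) :
    choice (ℳ.updStar ℳ.init u) ∈ H := by
  obtain ⟨s, x, hrun, h0, -, hchoice⟩ := h
  obtain ⟨hhub, hprefix⟩ := hrun.wordPrefix_of_toHub_zero h0
  have hstep := hrun u.length
  rwa [hchoice _ hhub, hprefix, hhub] at hstep

theorem WinsWith.mem_residual_of_leave (h : WinsWith ℳ W H choice u) {z : ℕ → C}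
    (hz : choice (ℳ.updStar ℳ.init u) = leave z) : z ∈ residual W u := by
  obtain ⟨s, x, hrun, h0, hx, hchoice⟩ := h
  obtain ⟨hhub, hprefix⟩ := hrun.wordPrefix_of_toHub_zero h0
  have hleave := hchoice _ hhub
  rw [hprefix, hz] at hleave
  rwa [mem_residual, ← hrun.eq_prepend_of_leave h0 hleave]

theorem WinsWith.mem_residual_of_loop (h : WinsWith ℳ W H choice u) {a : C} {l : List C}
    (hloop : choice (ℳ.updStar ℳ.init u) = (a, toHub l))
    (hstate : ℳ.updStar ℳ.init (u ++ a :: l) = ℳ.updStar ℳ.init u) {y : ℕ → C}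
    (hy : prepend (a :: l) y = y) : y ∈ residual W u := by
  obtain ⟨s, x, hrun, h0, hx, hchoice⟩ := h
  have hstep : ∀ n, s n = toHub [] →
      ℳ.updStar ℳ.init (wordPrefix x n) = ℳ.updStar ℳ.init u →
        (x n, s (n + 1)) = (a, toHub l) := fun n hn hm => by
    rw [hchoice n hn, hm, hloop]
  rwa [mem_residual, ← hrun.eq_prepend_of_loop h0 hstate hstep hy]

end HubChoice

theorem exists_isHubChoice {H : Set (C × Plan C)} {L : Set (List C)} {Z : Set (ℕ → C)}
    (hsuff : ∀ 𝒜 : Arena.{u, w} C, 𝒜.IsFinite → 𝒜.IsOnePlayer → ℳ.SufficesIn W 𝒜)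
    (hH : H.Finite) (hL : L.Finite) (hZ : Z.Finite) (hHne : H.Nonempty) (hLne : L.Nonempty)
    (hper : ∀ z ∈ Z, UltimatelyPeriodic z) (hHLZ : ∀ p ∈ H, p.2 ∈ plans L Z) :
    ∃ choice, IsHubChoice ℳ W H L choice := by
  obtain ⟨u₀, hu₀⟩ := hLne
  obtain ⟨nxt, hnxt⟩ := exists_isOptimalChoice_of_finite (δ := step H) (S := plans L Z) hsuff
    (finite_plans hL hZ hper) ⟨_, toHub_mem_plans hu₀ List.suffix_rfl⟩
    (fun _ hq _ hp => mem_plans_of_mem_step hHLZ hq hp) (fun q _ => finite_step hH q)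
    (fun q _ => nonempty_step hHne q)
  refine ⟨nxt (toHub []), fun u hu y hread hy => ?_⟩
  obtain ⟨s₀, hrun₀, hs₀⟩ := hread.prepend u
  obtain ⟨s, x, hrun, hs, hx, hchoice⟩ := hnxt s₀ (prepend u y) hrun₀
    (hs₀ ▸ toHub_mem_plans hu List.suffix_rfl) hy
  refine ⟨s, x, hrun, hs.trans hs₀, hx, fun n hn => ?_⟩
  rw [hchoice n, hn]

/-- If `u₁` and `u₂` lead to the same memory state, the choice made there at the hub is the same
after both of them, but `z₁` is the right answer only after `u₁`, and `z₂` only after `u₂`. -/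
theorem MemoryStructure.stronglyMonotone_of_sufficesIn
    (hsuff : ∀ 𝒜 : Arena.{u, w} C, 𝒜.IsFinite → 𝒜.IsOnePlayer → ℳ.SufficesIn W 𝒜)
    (hW : IsRegularReach W ∨ IsRegularReach Wᶜ) : ℳ.StronglyMonotone W := by
  rintro m _ ⟨u₁, hm₁, rfl⟩ _ ⟨u₂, hm₂, rfl⟩ -
  by_contra! ⟨h₁, h₂⟩
  obtain ⟨x₁, hx₁, hx₁'⟩ := Set.not_subset.1 h₁
  obtain ⟨x₂, hx₂, hx₂'⟩ := Set.not_subset.1 h₂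
  obtain ⟨z₁, hper₁, hz₁, hz₁'⟩ := exists_ultimatelyPeriodic_mem_residual_diff hW hx₁ hx₁'
  obtain ⟨z₂, hper₂, hz₂, hz₂'⟩ := exists_ultimatelyPeriodic_mem_residual_diff hW hx₂ hx₂'
  obtain ⟨choice, hchoice⟩ := exists_isHubChoice (H := {leave z₁, leave z₂}) (L := {u₁, u₂})
    (Z := {z₁, z₂}) hsuff (Set.toFinite _) (Set.toFinite _) (Set.toFinite _)
    (Set.insert_nonempty _ _) (Set.insert_nonempty _ _)
    (by rintro _ (rfl | rfl); exacts [hper₁, hper₂])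
    (by rintro _ (rfl | rfl); exacts [forever_mem_plans (Or.inl rfl) 1,
      forever_mem_plans (Or.inr rfl) 1])
  have hu₁ := hchoice u₁ (Or.inl rfl) z₁ (readable_of_leave_mem (Or.inl rfl)) hz₁
  have hu₂ := hchoice u₂ (Or.inr rfl) z₂ (readable_of_leave_mem (Or.inr rfl)) hz₂
  rcases hu₁.choice_mem with h | h
  · exact hz₁' (hu₂.mem_residual_of_leave (by rw [hm₂, ← hm₁, h]))
  · exact hz₂' (hu₁.mem_residual_of_leave h)

/-- After `u` and after `u ++ w` the memory state is the same, so the same choice is made at the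
hub. It cannot be to read `z`, which is wrong after `u`; hence it is to read `w` again and again. -/
theorem MemoryStructure.progressConsistent_of_sufficesIn
    (hsuff : ∀ 𝒜 : Arena.{u, w} C, 𝒜.IsFinite → 𝒜.IsOnePlayer → ℳ.SufficesIn W 𝒜)
    (hW : IsRegularReach W ∨ IsRegularReach Wᶜ) : ℳ.ProgressConsistent W := by
  intro u w hstate hlt y hy
  obtain ⟨x, hx, hx'⟩ := Set.exists_of_ssubset hlt
  obtain ⟨z, hper, hz, hz'⟩ := exists_ultimatelyPeriodic_mem_residual_diff hW hx hx'
  obtain _ | ⟨a, l⟩ := w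
  · rw [List.append_nil] at hlt
    exact absurd hlt (ssubset_irrefl _)
  obtain ⟨choice, hchoice⟩ := exists_isHubChoice (H := {(a, toHub l), leave z})
    (L := {u, a :: l}) (Z := {z}) hsuff (Set.toFinite _) (Set.toFinite _) (Set.toFinite _)
    (Set.insert_nonempty _ _) (Set.insert_nonempty _ _) (by rintro _ rfl; exact hper)
    (by rintro _ (rfl | rfl); exacts [toHub_mem_plans (Or.inr rfl) (List.suffix_cons a l),
      forever_mem_plans (Set.mem_singleton z) 1])
  rw [residual_append] at hz
  have hread : Readable {(a, toHub l), leave z} (toHub []) (prepend (a :: l) z) :=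
    ((readable_of_leave_mem (Or.inr rfl)).prepend l).cons (Or.inl rfl)
  have hu := hchoice u (Or.inl rfl) _ hread hz
  rcases hu.choice_mem with h | h
  · exact hu.mem_residual_of_loop h hstate hy
  · exact absurd (hu.mem_residual_of_leave h) hz'

end Necessity

end MemGame

theorem mainTheorem3 {C : Type u} [Nonempty C] {M : Type v} [Finite M]
    (ℳ : MemGame.MemoryStructure C M) (W : Set (ℕ → C)) (hW : MemGame.IsRegularObjective W) :
    (∀ 𝒜 : MemGame.Arena.{u, w} C, ℳ.SufficesIn W 𝒜) ↔
      (∀ 𝒜 : MemGame.Arena.{u, w} C, 𝒜.IsFinite → 𝒜.IsOnePlayer → ℳ.SufficesIn W 𝒜) := by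
  refine ⟨fun h 𝒜 _ _ => h 𝒜, fun hsuff => ?_⟩
  have hreg := hW.isRegularReach_or_compl
  have hmono := MemGame.MemoryStructure.stronglyMonotone_of_sufficesIn hsuff hreg
  have hprog := MemGame.MemoryStructure.progressConsistent_of_sufficesIn hsuff hreg
  rcases hreg with hreach | hsafe
  · exact hmono.sufficesIn_of_isRegularReach hprog hreach
  · exact hmono.sufficesIn_of_isRegularReach_compl hsafe
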